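/- Let $M$ be a monoid and let $\varphi\colon M\to G$ be its groupification, i.e. $G$ is a group and every homomorphism from $M$ to a group $H$ factors uniquely as $F\circ\varphi$ with $F\colon G\to H$ a homomorphism. Assume that $\varphi$ is injective (so that we may regard $M\subseteq G$). Let $BM$ be the geometric realization of the simplicial set whose $n$-simplices are the tuples $[x_1|\dots|x_n]$ with $x_i\in M$, with face maps $d_0[x_1|\dots|x_n]=[x_2|\dots|x_n]$, $d_i[x_1|\dots|x_n]=[x_1|\dots|x_ix_{i+1}|\dots|x_n]$ for $1\le i\le n-1$, $d_n[x_1|\dots|x_n]=[x_1|\dots|x_{n-1}]$, and degeneracy maps $s_i[x_1|\dots|x_n]=[x_1|\dots|x_i|1|x_{i+1}|\dots|x_n]$ for $0\le i\le n$. Let $EM$ be the geometric realization of the simplicial set whose $n$-simplices are the tuples $[g|x_1|\dots|x_n]$ with $g\in G$ and $x_i\in M$, with face maps $d_0[g|x_1|\dots|x_n]=[g\varphi(x_1)|x_2|\dots|x_n]$, $d_i[g|x_1|\dots|x_n]=[g|x_1|\dots|x_ix_{i+1}|\dots|x_n]$ for $1\le i\le n-1$, $d_n[g|x_1|\dots|x_n]=[g|x_1|\dots|x_{n-1}]$,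 and degeneracy maps $s_i[g|x_1|\dots|x_n]=[g|x_1|\dots|x_i|1|x_{i+1}|\dots|x_n]$ for $0\le i\le n$. Let $G$ act on $EM$ by the realizations of the simplicial maps $[g|x_1|\dots|x_n]\mapsto[hg|x_1|\dots|x_n]$, $h\in G$. Then $G$ acts on $EM$ by continuous maps and freely, the quotient map $q\colon EM\to EM/G$ is a covering map, and there is a homeomorphism $e\colon EM/G\to BM$ such that $p:=e\circ q$ is the realization of the simplicial map $[g|x_1|\dots|x_n]\mapsto[x_1|\dots|x_n]$. Moreover $p\colon EM\to BM$ is the universal cover of $BM$: it is a surjective covering map, and $EM$ is simply connected (path connected with trivial fundamental group). -/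

import Mathlib

universe u

/-! ### Groupification -/

/-- A homomorphism `φ : M →* G` from a monoid to a group exhibits `G` as the groupification of `M`:
every homomorphism from `M` to a group factors uniquely through `φ`. -/
def IsGroupification {M G : Type u} [Monoid M] [Group G] (φ : M →* G) : Prop :=
  ∀ (H : Type u) [Group H] (f : M →* H), ∃! F : G →* H, F.comp φ = f

namespace BarConstruction

open CategoryTheory Simplicial

section Tuples

variable {M : Type u} [Monoid M]

/-- For `x = (x_1, …, x_n)` and `i ≤ j ≤ n`, the ordered product `x_{i+1} x_{i+2} ⋯ x_j`. -/
def segProd {n : ℕ} (x : Fin n → M) (i j : ℕ) : M :=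
  (((List.ofFn x).take j).drop i).prod

lemma segProd_self {n : ℕ} (x : Fin n → M) (i : ℕ) : segProd x i i = 1 := by
  simp [segProd]

lemma segProd_mul {n : ℕ} (x : Fin n → M) {i j k : ℕ} (hij : i ≤ j) (hjk : j ≤ k) :
    segProd x i j * segProd x j k = segProd x i k := by
  unfold segProd
  rw [← List.prod_append]
  congr 1
  rw [← List.take_append_drop (j - i) (((List.ofFn x).take k).drop i), List.drop_drop]
  congr 1
  · rw [List.take_drop, List.take_take]
    congr 2
    omega
  · congr 1
    omega

lemma segProd_succ {n : ℕ} (x : Fin n → M) (i : Fin n) : segProd x i (i + 1) = x i := by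
  unfold segProd
  rw [List.take_succ_eq_append_getElem (by simp)]
  simp

/-- The action of a monotone map `f : {0, …, m} → {0, …, n}` on tuples: the `j`-th entry of the
result is the product `x_{f(j-1)+1} ⋯ x_{f(j)}`. -/
def pull {m n : ℕ} (f : Fin (m + 1) →o Fin (n + 1)) (x : Fin n → M) : Fin m → M :=
  fun j => segProd x (f j.castSucc) (f j.succ)

lemma segProd_pull {m n : ℕ} (f : Fin (m + 1) →o Fin (n + 1)) (x : Fin n → M)
    (i j : Fin (m + 1)) (hij : i ≤ j) :
    segProd (pull f x) i j = segProd x (f i) (f j) := by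
  induction j using Fin.induction with
  | zero =>
    obtain rfl : i = 0 := by simpa using hij
    simp [segProd_self]
  | succ j ih =>
    rcases hij.eq_or_lt with rfl | h
    · simp [segProd_self]
    · have h' : i ≤ j.castSucc := Fin.le_castSucc_iff.2 h
      rw [← segProd_mul (pull f x) (j := (j.castSucc : Fin (m + 1))) h' (by simp), ih h',
        ← segProd_mul x (i := f i) (j := f j.castSucc) (f.monotone h')
          (f.monotone (Fin.castSucc_lt_succ (i := j)).le)]
      congr 1
      exact segProd_succ (pull f x) j

lemma pull_id {n : ℕ} (x : Fin n → M) : pull OrderHom.id x = x := by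
  funext j
  exact segProd_succ x j

lemma pull_comp {l m n : ℕ} (f : Fin (l + 1) →o Fin (m + 1)) (g : Fin (m + 1) →o Fin (n + 1))
    (x : Fin n → M) : pull (g.comp f) x = pull f (pull g x) := by
  funext j
  exact (segProd_pull g x _ _ (f.monotone (Fin.castSucc_lt_succ (i := j)).le)).symm

end Tuples

/-! ### The simplicial sets -/

/-- The simplicial set whose `n`-simplices are the tuples `[x_1|…|x_n]` of elements of `M`; its
faces and degeneracies are computed in `bar_δ_zero`, `bar_δ_succ` and `bar_σ` below. -/
def bar (M : Type u) [Monoid M] : SSet.{u} where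
  obj Δ := Fin Δ.unop.len → M
  map f := ↾fun x => pull f.unop.toOrderHom x
  map_id _ := by
    refine ConcreteCategory.hom_ext _ _ fun x => ?_
    exact pull_id x
  map_comp f g := by
    refine ConcreteCategory.hom_ext _ _ fun x => ?_
    exact pull_comp g.unop.toOrderHom f.unop.toOrderHom x

variable {M G : Type u} [Monoid M] [Group G]

/-- The simplicial set whose `n`-simplices are the tuples `[g|x_1|…|x_n]` with `g : G` and
`x_i : M`; its faces and degeneracies are computed in `ebar_δ_zero`, `ebar_δ_succ` and `ebar_σ`
below. -/
def ebar (φ : M →* G) : SSet.{u} where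
  obj Δ := G × (Fin Δ.unop.len → M)
  map f := ↾fun s => (s.1 * φ (segProd s.2 0 (f.unop.toOrderHom 0)), pull f.unop.toOrderHom s.2)
  map_id _ := by
    refine ConcreteCategory.hom_ext _ _ fun s => ?_
    refine Prod.ext ?_ (pull_id s.2)
    exact (congrArg (fun y => s.1 * φ y) (segProd_self s.2 0)).trans (by simp)
  map_comp f g := by
    refine ConcreteCategory.hom_ext _ _ fun s => ?_
    refine Prod.ext ?_ (pull_comp g.unop.toOrderHom f.unop.toOrderHom s.2)
    change s.1 * φ (segProd s.2 0 (f.unop.toOrderHom (g.unop.toOrderHom 0))) =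
      s.1 * φ (segProd s.2 0 (f.unop.toOrderHom 0)) *
        φ (segProd (pull f.unop.toOrderHom s.2) 0 (g.unop.toOrderHom 0))
    have h := segProd_pull f.unop.toOrderHom s.2 0 (g.unop.toOrderHom 0) (Fin.zero_le _)
    have h' := segProd_mul s.2 (i := 0) (j := f.unop.toOrderHom 0)
      (k := f.unop.toOrderHom (g.unop.toOrderHom 0)) (Nat.zero_le _)
      (f.unop.toOrderHom.monotone (Fin.zero_le _))
    rw [mul_assoc, ← map_mul]
    rw [Fin.val_zero] at h
    rw [h, h']

/-- Left translation `[g|x_1|…|x_n] ↦ [hg|x_1|…|x_n]`. -/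
def translate (φ : M →* G) (h : G) : ebar φ ⟶ ebar φ where
  app _ := ↾fun s => (h * s.1, s.2)
  naturality _ _ f := by
    refine ConcreteCategory.hom_ext _ _ fun s => ?_
    exact Prod.ext (mul_assoc _ _ _).symm rfl

/-- The simplicial map `[g|x_1|…|x_n] ↦ [x_1|…|x_n]`. -/
def forget (φ : M →* G) : ebar φ ⟶ bar M where
  app _ := ↾fun s => s.2
  naturality _ _ _ := rfl

lemma translate_one (φ : M →* G) : translate φ 1 = 𝟙 (ebar φ) := by
  refine NatTrans.ext (funext fun Δ => ConcreteCategory.hom_ext _ _ fun s => ?_)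
  exact Prod.ext (one_mul _) rfl

lemma translate_mul (φ : M →* G) (h k : G) :
    translate φ (h * k) = translate φ k ≫ translate φ h := by
  refine NatTrans.ext (funext fun Δ => ConcreteCategory.hom_ext _ _ fun s => ?_)
  exact Prod.ext (mul_assoc _ _ _) rfl

/-! ### Faces and degeneracies

`Fin.tail x` is `(x_2, …, x_n)`; `Fin.contractNth i (· * ·) x` multiplies the entries number `i`
and `i + 1` (counted from `0`) and, for the largest value of `i`, drops the last entry;
`Fin.insertNth i 1 x` is `(x_1, …, x_i, 1, x_{i+1}, …, x_n)`. -/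

lemma pull_δ_zero {n : ℕ} (x : Fin (n + 1) → M) :
    pull (SimplexCategory.δ (n := n) 0).toOrderHom x = Fin.tail x := by
  funext j
  exact segProd_succ x j.succ

lemma pull_δ_succ {n : ℕ} (i : Fin (n + 1)) (x : Fin (n + 1) → M) :
    pull (SimplexCategory.δ (n := n) i.succ).toOrderHom x = Fin.contractNth i (· * ·) x := by
  funext j
  change segProd x (i.succ.succAbove j.castSucc) (i.succ.succAbove j.succ) = _
  rcases lt_trichotomy (j : ℕ) i with h | h | h
  · rw [Fin.contractNth_apply_of_lt _ _ _ _ h,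
      Fin.succAbove_of_castSucc_lt _ _ (by simp [Fin.lt_def]; omega),
      Fin.succAbove_of_castSucc_lt _ _ (by simp [Fin.lt_def]; omega)]
    exact segProd_succ x j.castSucc
  · rw [Fin.contractNth_apply_of_eq _ _ _ _ h,
      Fin.succAbove_of_castSucc_lt _ _ (by simp [Fin.lt_def]; omega),
      Fin.succAbove_of_le_castSucc _ _ (by simp [Fin.le_def]; omega)]
    rw [← segProd_succ x j.castSucc, ← segProd_succ x j.succ]
    refine (segProd_mul x ?_ ?_).symm <;> simp
  · rw [Fin.contractNth_apply_of_gt _ _ _ _ h,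
      Fin.succAbove_of_le_castSucc _ _ (by simp [Fin.le_def]; omega),
      Fin.succAbove_of_le_castSucc _ _ (by simp [Fin.le_def]; omega)]
    exact segProd_succ x j.succ

lemma pull_σ {n : ℕ} (i : Fin (n + 1)) (x : Fin n → M) :
    pull (SimplexCategory.σ (n := n) i).toOrderHom x = Fin.insertNth i (1 : M) x := by
  refine Fin.eq_insertNth_iff.2 ⟨?_, ?_⟩
  · change segProd x (i.predAbove i.castSucc) (i.predAbove i.succ) = 1
    simp [segProd_self]
  · funext j
    change segProd x (i.predAbove (i.succAbove j).castSucc) (i.predAbove (i.succAbove j).succ) = x j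
    rcases lt_or_ge j.castSucc i with h | h
    · rw [Fin.succAbove_of_castSucc_lt _ _ h,
        Fin.predAbove_of_le_castSucc _ _ (by simp [Fin.le_def, Fin.lt_def] at h ⊢; omega),
        Fin.predAbove_of_le_castSucc _ _ (by simp [Fin.le_def, Fin.lt_def] at h ⊢; omega)]
      exact segProd_succ x j
    · rw [Fin.succAbove_of_le_castSucc _ _ h,
        Fin.predAbove_of_castSucc_lt _ _ (by simp [Fin.le_def, Fin.lt_def] at h ⊢; omega),
        Fin.predAbove_of_castSucc_lt _ _ (by simp [Fin.le_def, Fin.lt_def] at h ⊢; omega)]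
      exact segProd_succ x j

lemma bar_δ_zero {n : ℕ} (x : Fin (n + 1) → M) :
    (bar M).δ (n := n) 0 x = Fin.tail x :=
  pull_δ_zero x

lemma bar_δ_succ {n : ℕ} (i : Fin (n + 1)) (x : Fin (n + 1) → M) :
    (bar M).δ (n := n) i.succ x = Fin.contractNth i (· * ·) x :=
  pull_δ_succ i x

lemma bar_σ {n : ℕ} (i : Fin (n + 1)) (x : Fin n → M) :
    (bar M).σ (n := n) i x = Fin.insertNth i (1 : M) x :=
  pull_σ i x

lemma ebar_δ_zero (φ : M →* G) {n : ℕ} (g : G) (x : Fin (n + 1) → M) :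
    (ebar φ).δ (n := n) 0 (g, x) = (g * φ (x 0), Fin.tail x) :=
  Prod.ext (congrArg (fun y => g * φ y) (segProd_succ x 0)) (pull_δ_zero x)

lemma ebar_δ_succ (φ : M →* G) {n : ℕ} (i : Fin (n + 1)) (g : G) (x : Fin (n + 1) → M) :
    (ebar φ).δ (n := n) i.succ (g, x) = (g, Fin.contractNth i (· * ·) x) := by
  refine Prod.ext ?_ (pull_δ_succ i x)
  change g * φ (segProd x 0 (i.succ.succAbove 0)) = g
  simp [segProd_self]

lemma ebar_σ (φ : M →* G) {n : ℕ} (i : Fin (n + 1)) (g : G) (x : Fin n → M) :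
    (ebar φ).σ (n := n) i (g, x) = (g, Fin.insertNth i (1 : M) x) := by
  refine Prod.ext ?_ (pull_σ i x)
  change g * φ (segProd x 0 (i.predAbove 0)) = g
  simp [segProd_self]

end BarConstruction

/-! ### The spaces -/

open BarConstruction in
/-- The classifying space of `M`: the geometric realization of `bar M`. -/
noncomputable def BM (M : Type u) [Monoid M] : TopCat.{u} := SSet.toTop.obj (bar M)

open BarConstruction in
/-- The geometric realization of `ebar φ`. -/
noncomputable def EM {M G : Type u} [Monoid M] [Group G] (φ : M →* G) : TopCat.{u} :=
  SSet.toTop.obj (ebar φ)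

namespace EM

open BarConstruction CategoryTheory

variable {M G : Type u} [Monoid M] [Group G]

/-- `h : G` acts on `EM φ` by the realization of `[g|x_1|…|x_n] ↦ [hg|x_1|…|x_n]`. -/
noncomputable instance instMulAction (φ : M →* G) : MulAction G (EM φ) where
  smul h z := SSet.toTop.map (translate φ h) z
  one_smul z := by
    change SSet.toTop.map (translate φ 1) z = z
    rw [translate_one, CategoryTheory.Functor.map_id]
    rfl
  mul_smul h k z := by
    change SSet.toTop.map (translate φ (h * k)) z =
      SSet.toTop.map (translate φ h) (SSet.toTop.map (translate φ k) z)
    rw [translate_mul, CategoryTheory.Functor.map_comp]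
    rfl

/-- The map `EM φ → BM M` realizing `[g|x_1|…|x_n] ↦ [x_1|…|x_n]`. -/
noncomputable def toBM (φ : M →* G) (z : EM φ) : BM M := SSet.toTop.map (forget φ) z

/-- The orbit space of the action of `G` on `EM φ`, with the quotient topology. -/
abbrev OrbitSpace (φ : M →* G) : Type u := MulAction.orbitRel.Quotient G (EM φ)

/-- The quotient map `EM φ → EM φ / G`. -/
noncomputable def toOrbitSpace (φ : M →* G) (z : EM φ) : OrbitSpace φ := Quotient.mk _ z

end EM

/-- A universal cover: a surjective covering map whose total space is simply connected (that is,
path connected with trivial fundamental group). -/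
structure IsUniversalCover {E X : Type u} [TopologicalSpace E] [TopologicalSpace X] (p : E → X) :
    Prop where
  isCoveringMap : IsCoveringMap p
  surjective : Function.Surjective p
  simplyConnectedSpace : SimplyConnectedSpace E

/-! `EM φ` is an ordered complex with vertices labelled by `G`, and `G` permutes the labels freely.
Barycentric coordinates cut `[0, 1]` into consecutive intervals labelled by vertices. For continuous
`κ`, the total increment of `κ` over the intervals labelled `g` is unchanged by faces and
degeneracies, so it is a continuous function on `EM φ` (`incrementMap`). Truncations `κ = min c`
yield neighbourhoods disjoint from their translates (`exists_nhds_disjoint_smul`). The fibres of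
`EM.toBM φ` are the orbits and it is a quotient map, so it is a quotient covering map.

Simple connectedness is proved without van Kampen. A path cocycle, i.e. a functor from the
fundamental groupoid to a group `π`, is shown to be a coboundary; for `π` the fundamental group this
kills all loops. On the edges `[g|x]` the cocycle satisfies `l g (x * y) = l g x * l (g * φ x) y`,
which is a homomorphism from `M` to a semidirect product of `G → π` by `G`. The universal property
extends it to `G`, and this extension trivializes the cocycle on vertices
(`IsGroupification.exists_trivialization`). The trivialization extends over simplices. It is
compatible with arbitrary paths because the open stars of vertices contract along paths inside
simplices (`track`). Injectivity of `φ` makes these contractions end at a vertex: an edge with both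
ends labelled `g` is degenerate. -/

/-! ### Characteristic maps of a geometric realization -/

namespace Realization

open CategoryTheory Simplicial Topology

variable {X Y : SSet.{u}}

/-- The characteristic map of a simplex `σ` of `X`. -/
noncomputable def realize {n : SimplexCategoryᵒᵖ} (σ : X.obj n) :
    C(stdSimplex ℝ (Fin (n.unop.len + 1)), SSet.toTop.obj X) :=
  TopCat.toSSetObjEquiv _ _ ((sSetTopAdj.unit.app X).app n σ)

lemma realize_map {m n : SimplexCategoryᵒᵖ} (f : n ⟶ m) (σ : X.obj n)
    (w : stdSimplex ℝ (Fin (m.unop.len + 1))) :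
    realize (X.map f σ) w = realize σ (stdSimplex.map f.unop.toOrderHom w) := by
  unfold realize
  have := NatTrans.naturality_apply (sSetTopAdj.unit.app X) f σ
  exact congr(TopCat.toSSetObjEquiv _ _ $this w)

lemma toTop_map_realize (f : X ⟶ Y) {n : SimplexCategoryᵒᵖ} (σ : X.obj n)
    (w : stdSimplex ℝ (Fin (n.unop.len + 1))) :
    SSet.toTop.map f (realize σ w) = realize (f.app n σ) w := by
  unfold realize
  have := sSetTopAdj.unit.naturality f
  have := congr($(this).app n σ)
  have h2 : (sSetTopAdj.unit.app Y).app n (f.app n σ) =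
     (TopCat.toSSet.map (SSet.toTop.map f)).app n ((sSetTopAdj.unit.app X).app n σ) := this
  rw [h2]
  rfl

/-- A family of continuous maps on the simplices of `X` which is compatible with the simplicial
operators. -/
structure SimplexFamily (X : SSet.{u}) (Z : Type u) [TopologicalSpace Z] where
  toFun {n : SimplexCategoryᵒᵖ} (σ : X.obj n) : C(stdSimplex ℝ (Fin (n.unop.len + 1)), Z)
  map {m n : SimplexCategoryᵒᵖ} (f : n ⟶ m) (σ : X.obj n)
    (w : stdSimplex ℝ (Fin (m.unop.len + 1))) :
    toFun (X.map f σ) w = toFun σ (stdSimplex.map f.unop.toOrderHom w)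

namespace SimplexFamily

variable {Z : Type u} [TopologicalSpace Z] (F : SimplexFamily X Z)

/-- The simplicial map to the singular simplicial set given by a compatible family. -/
noncomputable def toSing : X ⟶ TopCat.toSSet.obj (TopCat.of Z) where
  app n := ↾fun σ => (TopCat.toSSetObjEquiv (TopCat.of Z) n).symm (F.toFun σ)
  naturality m n f := by
    refine ConcreteCategory.hom_ext _ _ fun σ => ?_
    apply (TopCat.toSSetObjEquiv (TopCat.of Z) n).injective
    refine ContinuousMap.ext fun w => ?_
    exact F.map f σ w

/-- The continuous map on the realization glued from a compatible family. -/
noncomputable def desc : C(SSet.toTop.obj X, Z) :=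
  ((sSetTopAdj.homEquiv X (TopCat.of Z)).symm F.toSing).hom

lemma desc_realize {n : SimplexCategoryᵒᵖ} (σ : X.obj n)
    (w : stdSimplex ℝ (Fin (n.unop.len + 1))) : F.desc (realize σ w) = F.toFun σ w := by
  have h : sSetTopAdj.homEquiv X (TopCat.of Z) ((sSetTopAdj.homEquiv X (TopCat.of Z)).symm F.toSing)
    = F.toSing := Equiv.apply_symm_apply _ _
  rw [Adjunction.homEquiv_unit] at h
  have := congr((TopCat.toSSetObjEquiv (TopCat.of Z) n) ($(h).app n σ) w)
  exact this

end SimplexFamily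

lemma toTop_hom_ext {Z : Type u} [TopologicalSpace Z] {f g : C(SSet.toTop.obj X, Z)}
    (h : ∀ (n : SimplexCategoryᵒᵖ) (σ : X.obj n) w, f (realize σ w) = g (realize σ w)) :
    f = g := by
  have : TopCat.ofHom f = TopCat.ofHom g := by
    apply (sSetTopAdj.homEquiv X (TopCat.of Z)).injective
    rw [Adjunction.homEquiv_unit, Adjunction.homEquiv_unit]
    refine NatTrans.ext (funext fun n => ConcreteCategory.hom_ext _ _ fun σ => ?_)
    apply (TopCat.toSSetObjEquiv (TopCat.of Z) n).injective
    refine ContinuousMap.ext fun w => ?_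
    exact h n σ w
  exact congr(TopCat.Hom.hom $this)

lemma exists_realize (z : SSet.toTop.obj X) :
    ∃ (n : SimplexCategoryᵒᵖ) (σ : X.obj n) (w : stdSimplex ℝ (Fin (n.unop.len + 1))),
      realize σ w = z := by
  -- For the indiscrete topology every predicate is continuous, so two predicates that agree on all
  -- simplices are equal.
  let _ : TopologicalSpace (ULift.{u} Prop) := ⊤
  let f : C(SSet.toTop.obj X, ULift.{u} Prop) := ⟨fun z => ⟨∃ (n : SimplexCategoryᵒᵖ) (σ : X.obj n)
    (w : stdSimplex ℝ (Fin (n.unop.len + 1))), realize σ w = z⟩, continuous_top⟩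
  let g : C(SSet.toTop.obj X, ULift.{u} Prop) := ⟨fun z => ⟨True⟩, continuous_top⟩
  have h : f = g := toTop_hom_ext fun n σ w =>
    congrArg ULift.up (eq_true ⟨n, σ, w, rfl⟩)
  have h' : f z = g z := by rw [h]
  exact of_eq_true (congrArg ULift.down h')

/-- Compatible families of functions, without continuity, agree on the fibres of the
characteristic maps. -/
lemma eq_of_realize_eq {Z : Type u}
    (F : ∀ {n : SimplexCategoryᵒᵖ}, X.obj n → stdSimplex ℝ (Fin (n.unop.len + 1)) → Z)
    (hF : ∀ {m n : SimplexCategoryᵒᵖ} (f : n ⟶ m) (σ : X.obj n) w,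
      F (X.map f σ) w = F σ (stdSimplex.map f.unop.toOrderHom w))
    {m n : SimplexCategoryᵒᵖ} {σ : X.obj m} {τ : X.obj n} {v w}
    (h : realize σ v = realize τ w) : F σ v = F τ w := by
  let _ : TopologicalSpace Z := ⊤
  let F' : SimplexFamily X Z := ⟨fun σ => ⟨F σ, continuous_top⟩, hF⟩
  have h' := congrArg F'.desc h
  rwa [F'.desc_realize, F'.desc_realize] at h'

/-- Open sets are the continuous maps to the Sierpiński space `Prop`, and such maps glue from
simplices. -/
lemma isOpen_toTop_iff {U : Set (SSet.toTop.obj X)} :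
    IsOpen U ↔ ∀ (n : SimplexCategoryᵒᵖ) (σ : X.obj n), IsOpen (realize σ ⁻¹' U) := by
  refine ⟨fun h n σ => h.preimage (realize σ).continuous, fun h => ?_⟩
  let F : SimplexFamily X (ULift.{u} Prop) :=
    ⟨fun σ => ⟨fun w => ⟨realize σ w ∈ U⟩, continuous_uliftUp.comp (continuous_Prop.2 (h _ σ))⟩,
      fun f σ w => congrArg (fun z => ULift.up (z ∈ U)) (realize_map f σ w)⟩
  have hF : ∀ z, (F.desc z).down ↔ z ∈ U := by
    intro z
    obtain ⟨n, σ, w, rfl⟩ := exists_realize z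
    rw [F.desc_realize]
    rfl
  have h' : IsOpen {z | (F.desc z).down} :=
    continuous_Prop.1 (continuous_uliftDown.comp F.desc.continuous)
  rwa [Set.ext hF (b := U)] at h'

end Realization

/-! ### Partial sums of barycentric coordinates -/

namespace stdSimplex

open Finset

lemma map_apply {X Y : Type*} [Fintype X] [Fintype Y] [DecidableEq Y] (f : X → Y)
    (w : stdSimplex ℝ X) (y : Y) : stdSimplex.map f w y = ∑ x with f x = y, w x :=
  FunOnFinite.linearMap_apply_apply ℝ ℝ f w y

lemma continuous_eval {X : Type*} [Fintype X] (x : X) :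
    Continuous fun w : stdSimplex ℝ X => w x :=
  (continuous_apply x).comp continuous_subtype_val

/-- The sum of the barycentric coordinates with index less than `a`. -/
noncomputable def partialSum {m : ℕ} (w : stdSimplex ℝ (Fin m)) (a : ℕ) : ℝ :=
  ∑ i : Fin m with i.val < a, w i

variable {m n : ℕ}

lemma continuous_partialSum (a : ℕ) : Continuous fun w : stdSimplex ℝ (Fin m) => partialSum w a :=
  continuous_finsetSum _ fun i _ => continuous_eval i

lemma sum_lt_succ {M : Type*} [AddCommMonoid M] (F : Fin m → M) {a : ℕ} (ha : a < m) :
    ∑ i : Fin m with i.val < a + 1, F i = ∑ i : Fin m with i.val < a, F i + F ⟨a, ha⟩ := by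
  have : (univ.filter fun i : Fin m => i.val < a + 1) =
      insert ⟨a, ha⟩ (univ.filter fun i : Fin m => i.val < a) := by
    ext i
    simp [Fin.ext_iff]
    omega
  rw [this, sum_insert (by simp), add_comm]

lemma partialSum_zero (w : stdSimplex ℝ (Fin m)) : partialSum w 0 = 0 := by
  simp [partialSum]

lemma partialSum_succ (w : stdSimplex ℝ (Fin m)) (i : Fin m) :
    partialSum w (i + 1) = partialSum w i + w i :=
  sum_lt_succ _ i.2

lemma partialSum_last (w : stdSimplex ℝ (Fin m)) : partialSum w m = 1 := by
  rw [← sum_eq_one w, partialSum, filter_true_of_mem fun i _ => i.2]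

lemma partialSum_mono (w : stdSimplex ℝ (Fin m)) : Monotone (partialSum w) := fun a b h =>
  sum_le_sum_of_subset_of_nonneg (fun i => by simp; omega) fun i _ _ => zero_le w i

lemma sum_telescope (w : stdSimplex ℝ (Fin m)) (κ : ℝ → ℝ) (a : ℕ) :
    ∑ i : Fin m with i.val < a, (κ (partialSum w (i + 1)) - κ (partialSum w i)) =
      κ (partialSum w a) - κ 0 := by
  induction a with
  | zero => simp [partialSum_zero]
  | succ a ih =>
    by_cases ha : a < m
    · rw [sum_lt_succ _ ha, ih]
      ring
    · have h1 : ∀ {M : Type} [AddCommMonoid M] (F : Fin m → M),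
          ∑ i : Fin m with i.val < a + 1, F i = ∑ i : Fin m with i.val < a, F i := fun F =>
        sum_congr (filter_congr fun i _ => by omega) fun _ _ => rfl
      rw [h1, ih, partialSum, partialSum, h1]

/-- The preimage of an initial segment under a monotone map is an initial segment. -/
lemma exists_lt_iff (θ : Fin m →o Fin n) (b : ℕ) : ∃ a : ℕ, ∀ i, (θ i : ℕ) < b ↔ (i : ℕ) < a := by
  refine ⟨(univ.filter fun i => (θ i : ℕ) < b).sup fun i => (i : ℕ) + 1, fun i => ?_⟩
  rw [Finset.lt_sup_iff]
  constructor
  · exact fun h => ⟨i, by simpa using h, by omega⟩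
  · rintro ⟨j, hj, hij⟩
    have : θ i ≤ θ j := θ.monotone (Fin.le_def.2 (by omega))
    simp at hj
    have := Fin.le_def.1 this
    omega

lemma partialSum_map (θ : Fin m →o Fin n) (w : stdSimplex ℝ (Fin m)) (b : ℕ) :
    partialSum (stdSimplex.map θ w) b = ∑ i : Fin m with (θ i : ℕ) < b, w i := by
  simp only [partialSum, map_apply]
  rw [← sum_fiberwise (univ.filter fun i => (θ i : ℕ) < b) θ, sum_filter]
  refine sum_congr rfl fun j _ => ?_
  rw [filter_filter]
  split_ifs with h
  · exact sum_congr (filter_congr fun i _ => by grind) fun _ _ => rfl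
  · rw [filter_false_of_mem fun i _ => by grind, sum_empty]

lemma sum_map_lt (θ : Fin m →o Fin n) (w : stdSimplex ℝ (Fin m)) (κ : ℝ → ℝ) (b : ℕ) :
    ∑ i : Fin m with (θ i : ℕ) < b, (κ (partialSum w (i + 1)) - κ (partialSum w i)) =
      κ (partialSum (stdSimplex.map θ w) b) - κ 0 := by
  obtain ⟨a, ha⟩ := exists_lt_iff θ b
  rw [partialSum_map]
  simp only [ha]
  exact sum_telescope w κ a

/-- A fibre of a monotone map is a run of consecutive indices. Their intervals join up to the
interval of `j`, as a difference of two initial segments. -/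
lemma sum_map_fiber (θ : Fin m →o Fin n) (w : stdSimplex ℝ (Fin m)) (κ : ℝ → ℝ) (j : Fin n) :
    ∑ i with θ i = j, (κ (partialSum w (i + 1)) - κ (partialSum w i)) =
      κ (partialSum (stdSimplex.map θ w) (j + 1)) - κ (partialSum (stdSimplex.map θ w) j) := by
  have h := sum_map_lt θ w κ (j + 1)
  rw [← sum_filter_add_sum_filter_not _ (fun i => (θ i : ℕ) < j), filter_filter, filter_filter,
    show (univ.filter fun i => (θ i : ℕ) < j + 1 ∧ (θ i : ℕ) < j) =
      univ.filter fun i => (θ i : ℕ) < j from filter_congr fun i _ => by omega,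
    show (univ.filter fun i => (θ i : ℕ) < j + 1 ∧ ¬ (θ i : ℕ) < j) =
      univ.filter fun i => θ i = j from filter_congr fun i _ => by simp [Fin.ext_iff]; omega,
    sum_map_lt] at h
  linarith

lemma sum_filter_map {G : Type*} [DecidableEq G] (θ : Fin m →o Fin n) (v : Fin n → G) (g : G)
    (w : stdSimplex ℝ (Fin m)) (κ : ℝ → ℝ) :
    ∑ i with v (θ i) = g, (κ (partialSum w (i + 1)) - κ (partialSum w i)) =
      ∑ j with v j = g, (κ (partialSum (stdSimplex.map θ w) (j + 1)) -
        κ (partialSum (stdSimplex.map θ w) j)) := by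
  simp only [← sum_map_fiber]
  rw [← sum_fiberwise (univ.filter fun i => v (θ i) = g) θ, sum_filter]
  refine sum_congr rfl fun j _ => ?_
  rw [filter_filter]
  split_ifs with h
  · exact sum_congr (filter_congr fun i _ => by grind) fun _ _ => rfl
  · rw [filter_false_of_mem fun i _ => by grind, sum_empty]

end stdSimplex

/-! ### The action of `G` on `EM φ` and its quotient -/

namespace BarConstruction

open CategoryTheory Realization Finset Topology

attribute [local instance] Classical.propDecidable

variable {M G : Type u} [Monoid M] [Group G] {φ : M →* G}

/-- The `i`-th vertex of the simplex `[g|x_1|…|x_n]` is `g x_1 ⋯ x_i`. -/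
def vert {n : SimplexCategoryᵒᵖ} (σ : (ebar φ).obj n) (i : Fin (n.unop.len + 1)) : G :=
  σ.1 * φ (segProd σ.2 0 i)

lemma vert_map {m n : SimplexCategoryᵒᵖ} (f : n ⟶ m) (σ : (ebar φ).obj n)
    (i : Fin (m.unop.len + 1)) :
    vert ((ebar φ).map f σ) i = vert σ (f.unop.toOrderHom i) := by
  change σ.1 * φ (segProd σ.2 0 (f.unop.toOrderHom 0)) *
    φ (segProd (pull f.unop.toOrderHom σ.2) 0 i) = σ.1 * φ (segProd σ.2 0 (f.unop.toOrderHom i))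
  have h := segProd_pull f.unop.toOrderHom σ.2 0 i (Fin.zero_le _)
  rw [Fin.val_zero] at h
  rw [h, mul_assoc, ← map_mul, segProd_mul _ (Nat.zero_le _)
    (f.unop.toOrderHom.monotone (Fin.zero_le _))]

lemma vert_translate {n : SimplexCategoryᵒᵖ} (h : G) (σ : (ebar φ).obj n)
    (i : Fin (n.unop.len + 1)) : vert ((translate φ h).app n σ) i = h * vert σ i :=
  mul_assoc _ _ _

/-- The simplex `[g|x_1|…|x_n]` of `ebar φ`. -/
def tuple (φ : M →* G) {n : SimplexCategoryᵒᵖ} (g : G) (x : (bar M).obj n) : (ebar φ).obj n :=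
  (g, x)

/-- The characteristic map of a simplex of `ebar φ`. -/
noncomputable def cell {n : SimplexCategoryᵒᵖ} (σ : (ebar φ).obj n) :
    C(stdSimplex ℝ (Fin (n.unop.len + 1)), EM φ) :=
  realize σ

lemma cell_map {m n : SimplexCategoryᵒᵖ} (f : n ⟶ m) (σ : (ebar φ).obj n)
    (w : stdSimplex ℝ (Fin (m.unop.len + 1))) :
    cell ((ebar φ).map f σ) w = cell σ (stdSimplex.map f.unop.toOrderHom w) :=
  realize_map f σ w

lemma exists_cell (z : EM φ) : ∃ (n : SimplexCategoryᵒᵖ) (σ : (ebar φ).obj n)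
    (w : stdSimplex ℝ (Fin (n.unop.len + 1))), cell σ w = z :=
  exists_realize z

/-- A simplex with barycentric coordinates `w` subdivides the unit interval into intervals indexed
by its vertices. This is the total increment of `κ` over the intervals labelled by `g`. -/
noncomputable def increment (κ : ℝ → ℝ) (g : G) {n : SimplexCategoryᵒᵖ} (σ : (ebar φ).obj n)
    (w : stdSimplex ℝ (Fin (n.unop.len + 1))) : ℝ :=
  ∑ i with vert σ i = g, (κ (stdSimplex.partialSum w (i + 1)) -
    κ (stdSimplex.partialSum w i))

/-- The function on `EM φ` given by `increment` on each simplex. -/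
noncomputable def incrementMap (φ : M →* G) (κ : C(ℝ, ℝ)) (g : G) : C(EM φ, ℝ) :=
  let F : SimplexFamily (ebar φ) (ULift.{u} ℝ) :=
    { toFun := fun σ => ⟨fun w => ⟨increment κ g σ w⟩, continuous_uliftUp.comp <|
        continuous_finsetSum _ fun i _ =>
          (κ.continuous.comp (stdSimplex.continuous_partialSum _)).sub
            (κ.continuous.comp (stdSimplex.continuous_partialSum _))⟩
      map := fun f σ w => by
        refine congrArg ULift.up ?_
        simp only [increment, vert_map]
        exact stdSimplex.sum_filter_map _ (vert σ) g w κ }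
  ⟨fun z => (F.desc z).down, continuous_uliftDown.comp F.desc.continuous⟩

lemma incrementMap_cell (κ : C(ℝ, ℝ)) (g : G) {n : SimplexCategoryᵒᵖ} (σ : (ebar φ).obj n)
    (w : stdSimplex ℝ (Fin (n.unop.len + 1))) :
    incrementMap φ κ g (cell σ w) = increment κ g σ w :=
  congrArg ULift.down (SimplexFamily.desc_realize _ σ w)

lemma smul_cell {n : SimplexCategoryᵒᵖ} (h : G) (σ : (ebar φ).obj n)
    (w : stdSimplex ℝ (Fin (n.unop.len + 1))) :
    h • cell σ w = cell ((translate φ h).app n σ) w :=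
  toTop_map_realize (translate φ h) σ w

lemma incrementMap_smul (κ : C(ℝ, ℝ)) (g h : G) (z : EM φ) :
    incrementMap φ κ (h * g) (h • z) = incrementMap φ κ g z := by
  obtain ⟨n, σ, w, rfl⟩ := exists_cell z
  rw [smul_cell, incrementMap_cell, incrementMap_cell, increment, increment]
  simp only [vert_translate, mul_right_inj]

/-- Distinct labels own disjoint sets of intervals, and the nonnegative increments over all
intervals telescope to `κ 1 - κ 0`. -/
lemma incrementMap_add_le {κ : C(ℝ, ℝ)} (hκ : Monotone κ) {g h : G} (hgh : g ≠ h) (z : EM φ) :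
    incrementMap φ κ g z + incrementMap φ κ h z ≤ κ 1 - κ 0 := by
  obtain ⟨n, σ, w, rfl⟩ := exists_cell z
  rw [incrementMap_cell, incrementMap_cell, increment, increment, ← sum_union]
  · have := stdSimplex.sum_telescope w κ (n.unop.len + 1)
    rw [stdSimplex.partialSum_last, filter_true_of_mem fun i _ => i.2] at this
    rw [← this]
    refine sum_le_sum_of_subset_of_nonneg (subset_univ _) fun i _ _ => ?_
    exact sub_nonneg.2 (hκ (stdSimplex.partialSum_mono w (Nat.le_succ _)))
  · exact disjoint_filter.2 fun i _ h1 h2 => hgh (h1.symm.trans h2)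

/-- `fun x => min c x` as a continuous map. -/
def minMap (c : ℝ) : C(ℝ, ℝ) := ⟨fun x => min c x, by fun_prop⟩

/-- Take the first vertex of positive weight, its weight `c` and its label `g`. Its interval is `[0,
c]`, where `min c` performs its whole rise. The plain weight of `g` would not do, since it need not
exceed half of the total. -/
lemma exists_incrementMap_eq (z : EM φ) :
    ∃ c : ℝ, 0 < c ∧ ∃ g : G, c ≤ incrementMap φ (minMap c) g z := by
  obtain ⟨n, σ, w, rfl⟩ := exists_cell z
  have hne : (univ.filter fun i => 0 < w i).Nonempty := by
    by_contra h
    have h0 : ∀ i, w i = 0 := fun i => by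
      refine le_antisymm (not_lt.1 fun hi => h ⟨i, by simpa using hi⟩) (stdSimplex.zero_le w i)
    have := stdSimplex.sum_eq_one w
    simp [h0] at this
  let i := (univ.filter fun i => 0 < w i).min' hne
  have hi : 0 < w i := by simpa using Finset.min'_mem _ hne
  have hlt : stdSimplex.partialSum w i = 0 := by
    refine sum_eq_zero fun j hj => ?_
    by_contra hj'
    have : i ≤ j := Finset.min'_le _ _
      (by simpa using lt_of_le_of_ne (stdSimplex.zero_le w j) (Ne.symm hj'))
    simp at hj
    exact absurd this (not_le.2 hj)
  refine ⟨w i, hi, vert σ i, ?_⟩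
  rw [incrementMap_cell, increment]
  have key : minMap (w i) (stdSimplex.partialSum w (i + 1)) -
      minMap (w i) (stdSimplex.partialSum w i) = w i := by
    rw [stdSimplex.partialSum_succ w, hlt]
    simp [minMap, hi.le]
  refine le_trans key.ge (single_le_sum (f := fun i : Fin (n.unop.len + 1) =>
    minMap (w _) (stdSimplex.partialSum w (i + 1)) -
      minMap (w _) (stdSimplex.partialSum w i)) (fun j _ => ?_)
    (by simp : i ∈ _))
  exact sub_nonneg.2 (min_le_min_left _ (stdSimplex.partialSum_mono w (Nat.le_succ _)))

/-- All increments of `min c` add up to at most `c`, so no two labels can both have more than `c /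
2`. If `y` and `h • y` both lie in the set where `g` does, then at `h • y` both `g` and `h * g` do.
-/
lemma exists_nhds_disjoint_smul (z : EM φ) :
    ∃ U ∈ 𝓝 z, ∀ h : G, (((h • ·) '' U) ∩ U).Nonempty → h = 1 := by
  obtain ⟨c, hc, g, hg⟩ := exists_incrementMap_eq z
  refine ⟨{y | c / 2 < incrementMap φ (minMap c) g y},
    (isOpen_lt continuous_const (ContinuousMap.continuous _)).mem_nhds
      (show c / 2 < _ by linarith), ?_⟩
  rintro h ⟨_, ⟨y, hy, rfl⟩, hy'⟩
  by_contra hne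
  have h1 : incrementMap φ (minMap c) (h * g) (h • y) = incrementMap φ (minMap c) g y :=
    incrementMap_smul _ _ _ _
  have h2 := incrementMap_add_le (φ := φ) (κ := minMap c) (fun a b hab => min_le_min_left _ hab)
    (g := h * g) (h := g) (by simpa using hne) (h • y)
  have h3 : minMap c 1 - minMap c 0 ≤ c := by
    simp [minMap, hc.le]
  simp only [Set.mem_ofPred_eq] at hy hy'
  linarith

lemma continuous_smul (h : G) : Continuous fun z : EM φ => h • z :=
  (SSet.toTop.map (translate φ h)).hom.continuous

lemma toBM_smul (h : G) (z : EM φ) : EM.toBM φ (h • z) = EM.toBM φ z := by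
  change (SSet.toTop.map (translate φ h) ≫ SSet.toTop.map (forget φ)) z = _
  rw [← Functor.map_comp]
  rfl

lemma toBM_cell {n : SimplexCategoryᵒᵖ} (σ : (ebar φ).obj n)
    (w : stdSimplex ℝ (Fin (n.unop.len + 1))) :
    EM.toBM φ (cell σ w) = realize (X := bar M) (n := n) σ.2 w :=
  toTop_map_realize (forget φ) σ w

lemma toOrbitSpace_smul (h : G) (z : EM φ) :
    EM.toOrbitSpace φ (h • z) = EM.toOrbitSpace φ z :=
  Quotient.sound ⟨h, rfl⟩

/-- Lifting a simplex `x` of `bar M` to `[1|x]` commutes with the simplicial operators up to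
translation. It therefore induces a well-defined map from `BM M` to the orbit space, inverse to the
projection. -/
lemma toOrbitSpace_eq_of_toBM_eq {y z : EM φ} (hyz : EM.toBM φ y = EM.toBM φ z) :
    EM.toOrbitSpace φ y = EM.toOrbitSpace φ z := by
  obtain ⟨m, σ, v, rfl⟩ := exists_cell y
  obtain ⟨n, τ, w, rfl⟩ := exists_cell z
  rw [toBM_cell, toBM_cell] at hyz
  have key : ∀ {n : SimplexCategoryᵒᵖ} (g : G) (x : (bar M).obj n)
      (w : stdSimplex ℝ (Fin (n.unop.len + 1))),
      EM.toOrbitSpace φ (cell (tuple φ g x) w) =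
        EM.toOrbitSpace φ (cell (tuple φ 1 x) w) := by
    intro n g x w
    rw [← toOrbitSpace_smul g (cell (tuple φ 1 x) w), smul_cell]
    exact congrArg (fun g' => EM.toOrbitSpace φ (cell (tuple φ g' x) w)) (mul_one g).symm
  have h := eq_of_realize_eq (X := bar M)
    (fun {n} x w => EM.toOrbitSpace φ (cell (tuple φ 1 x) w))
    (fun {m n} f x w => by
      refine Eq.trans ?_ (congrArg (EM.toOrbitSpace φ) (cell_map f (tuple φ 1 x) w))
      exact (key _ _ w).symm) hyz
  exact (key σ.1 σ.2 v).trans (h.trans (key τ.1 τ.2 w).symm)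

lemma toBM_eq_iff {y z : EM φ} : EM.toBM φ y = EM.toBM φ z ↔ y ∈ MulAction.orbit G z := by
  refine ⟨fun h => Quotient.exact (toOrbitSpace_eq_of_toBM_eq h), ?_⟩
  rintro ⟨h, rfl⟩
  exact toBM_smul h z

lemma toBM_surjective : Function.Surjective (EM.toBM φ) := by
  intro z
  obtain ⟨n, x, w, rfl⟩ := exists_realize z
  exact ⟨cell (tuple φ 1 x) w, toBM_cell _ w⟩

lemma continuous_toBM : Continuous (EM.toBM φ) := (SSet.toTop.map (forget φ)).hom.continuous

/-- Openness in `BM M` is tested on simplices, and each simplex lifts to `EM φ`. -/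
lemma isQuotientMap_toBM : IsQuotientMap (EM.toBM φ) := by
  refine ⟨isCoinducing_iff.2 fun U => ⟨fun h => isOpen_toTop_iff.2 fun n x => ?_,
    fun h => h.preimage continuous_toBM⟩, toBM_surjective⟩
  have := h.preimage (cell (tuple φ 1 x)).continuous
  convert this using 1
  ext w
  exact (iff_of_eq (congrArg (· ∈ U) (toBM_cell (tuple φ 1 x) w))).symm

lemma isQuotientCoveringMap_toBM : IsQuotientCoveringMap (EM.toBM φ) G where
  toIsQuotientMap := isQuotientMap_toBM
  continuous_const_smul := continuous_smul
  apply_eq_iff_mem_orbit := toBM_eq_iff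
  disjoint := exists_nhds_disjoint_smul

/-- The bijection from the orbit space of `EM φ` to `BM M`. -/
noncomputable def orbitSpaceEquiv (φ : M →* G) : EM.OrbitSpace φ ≃ BM M :=
  Equiv.ofBijective (Quotient.lift (EM.toBM φ) fun _ _ h => toBM_eq_iff.2 h)
    ⟨by
      rintro ⟨y⟩ ⟨z⟩ h
      exact toOrbitSpace_eq_of_toBM_eq h,
    fun z => (toBM_surjective z).imp' (EM.toOrbitSpace φ) fun _ h => h⟩

lemma orbitSpaceEquiv_toOrbitSpace (z : EM φ) :
    orbitSpaceEquiv φ (EM.toOrbitSpace φ z) = EM.toBM φ z := rfl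

/-- The identification of the orbit space of `EM φ` with `BM M`. -/
noncomputable def orbitSpaceHomeomorph (φ : M →* G) : EM.OrbitSpace φ ≃ₜ BM M where
  toEquiv := orbitSpaceEquiv φ
  continuous_toFun := continuous_toBM.quotient_lift _
  continuous_invFun := by
    refine (isQuotientMap_toBM (φ := φ)).continuous_iff.2 ?_
    have : Continuous (EM.toOrbitSpace φ) := continuous_quotient_mk'
    convert this using 1
    funext z
    exact (Equiv.symm_apply_eq _).2 (orbitSpaceEquiv_toOrbitSpace z).symm

end BarConstruction

/-! ### Contracting the open star of a vertex -/

namespace stdSimplex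

/-- Rescale the barycentric coordinates by nonnegative factors for which the sum of the
coordinates remains `1`. -/
def rescale {X : Type*} [Fintype X] (w : stdSimplex ℝ X) (r : X → ℝ) (h0 : ∀ x, 0 ≤ r x)
    (h1 : ∑ x, w x * r x = 1) : stdSimplex ℝ X :=
  ⟨fun x => w x * r x, fun x => mul_nonneg (zero_le w x) (h0 x), h1⟩

end stdSimplex

namespace BarConstruction

open CategoryTheory Realization Finset Topology

attribute [local instance] Classical.propDecidable

variable {M G : Type u} [Monoid M] [Group G] {φ : M →* G}

/-- The vertex `g` of `EM φ`. -/
noncomputable def vertexPoint (φ : M →* G) (g : G) : EM φ :=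
  cell (tuple φ (n := .op (.mk 0)) g Fin.elim0) default

/-- The sum of the barycentric coordinates of the vertices labelled by `g`. -/
noncomputable def mass (g : G) {n : SimplexCategoryᵒᵖ} (σ : (ebar φ).obj n)
    (w : stdSimplex ℝ (Fin (n.unop.len + 1))) : ℝ :=
  ∑ i with vert σ i = g, w i

lemma increment_id (g : G) {n : SimplexCategoryᵒᵖ} (σ : (ebar φ).obj n)
    (w : stdSimplex ℝ (Fin (n.unop.len + 1))) :
    increment (ContinuousMap.id ℝ) g σ w = mass g σ w := by
  refine sum_congr rfl fun i _ => ?_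
  simp [stdSimplex.partialSum_succ]

lemma incrementMap_id_cell (g : G) {n : SimplexCategoryᵒᵖ} (σ : (ebar φ).obj n)
    (w : stdSimplex ℝ (Fin (n.unop.len + 1))) :
    incrementMap φ (.id ℝ) g (cell σ w) = mass g σ w := by
  rw [incrementMap_cell, increment_id]

lemma mass_map {m n : SimplexCategoryᵒᵖ} (f : n ⟶ m) (g : G) (σ : (ebar φ).obj n)
    (w : stdSimplex ℝ (Fin (m.unop.len + 1))) :
    mass g ((ebar φ).map f σ) w = mass g σ (stdSimplex.map f.unop.toOrderHom w) := by
  rw [← incrementMap_id_cell, ← incrementMap_id_cell, cell_map]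

lemma mass_nonneg (g : G) {n : SimplexCategoryᵒᵖ} (σ : (ebar φ).obj n)
    (w : stdSimplex ℝ (Fin (n.unop.len + 1))) : 0 ≤ mass g σ w :=
  sum_nonneg fun i _ => stdSimplex.zero_le w i

lemma continuous_mass (g : G) {n : SimplexCategoryᵒᵖ} (σ : (ebar φ).obj n) :
    Continuous (mass g σ) :=
  continuous_finsetSum _ fun i _ => stdSimplex.continuous_eval i

/-- The open star of the vertex `g`. -/
def star (φ : M →* G) (g : G) : Set (EM φ) := {z | 0 < incrementMap φ (.id ℝ) g z}

lemma isOpen_star (g : G) : IsOpen (star φ g) :=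
  isOpen_lt continuous_const (ContinuousMap.continuous _)

lemma cell_mem_star {g : G} {n : SimplexCategoryᵒᵖ} {σ : (ebar φ).obj n}
    {w : stdSimplex ℝ (Fin (n.unop.len + 1))} : cell σ w ∈ star φ g ↔ 0 < mass g σ w := by
  rw [← incrementMap_id_cell]
  rfl

lemma exists_mem_star (z : EM φ) : ∃ g, z ∈ star φ g := by
  obtain ⟨n, σ, w, rfl⟩ := exists_cell z
  obtain ⟨i, hi⟩ : ∃ i, 0 < w i := by
    by_contra! h
    have := stdSimplex.sum_eq_one w
    rw [sum_eq_zero fun i _ => le_antisymm (h i) (stdSimplex.zero_le w i)] at this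
    exact zero_ne_one this
  refine ⟨vert σ i, cell_mem_star.2 (hi.trans_le ?_)⟩
  exact single_le_sum (f := fun i => w i) (fun j _ => stdSimplex.zero_le w j) (by simp)

/-- The factor by which the barycentric coordinate of a vertex labelled by `h` changes at time `t`
of the contraction of the star of `g`. -/
noncomputable def contractFactor {A : Type*} (g h : A) (t l : ℝ) : ℝ :=
  -- The value `1` for `l ≤ 0` makes the contraction stationary off the star, so that it is a
  -- compatible family on all simplices.
  if 0 < l then (1 - t) + (if h = g then t / l else 0) else 1

lemma contractFactor_nonneg {A : Type*} (g h : A) (t : unitInterval) {l : ℝ} (hl : 0 ≤ l) :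
    0 ≤ contractFactor g h t l := by
  unfold contractFactor
  have h0 := sub_nonneg.2 t.2.2
  have h1 := div_nonneg t.2.1 hl
  split_ifs <;> positivity

lemma sum_mul_contractFactor (g : G) (t : ℝ) {n : SimplexCategoryᵒᵖ} (σ : (ebar φ).obj n)
    (w : stdSimplex ℝ (Fin (n.unop.len + 1))) :
    ∑ i, w i * contractFactor g (vert σ i) t (mass g σ w) = 1 := by
  unfold contractFactor
  split_ifs with h
  · simp only [mul_add, mul_ite, mul_zero, sum_add_distrib, ← sum_mul, stdSimplex.sum_eq_one,
      ← sum_filter]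
    change _ + mass g σ w * _ = 1
    field_simp
    ring
  · simp

/-- The straight line contraction within a simplex. -/
noncomputable def contract (g : G) {n : SimplexCategoryᵒᵖ} (σ : (ebar φ).obj n)
    (w : stdSimplex ℝ (Fin (n.unop.len + 1))) (t : unitInterval) :
    stdSimplex ℝ (Fin (n.unop.len + 1)) :=
  stdSimplex.rescale w (fun i => contractFactor g (vert σ i) t (mass g σ w))
    (fun _ => contractFactor_nonneg _ _ t (mass_nonneg _ _ _)) (sum_mul_contractFactor _ _ _ _)

lemma contract_apply (g : G) {n : SimplexCategoryᵒᵖ} (σ : (ebar φ).obj n)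
    (w : stdSimplex ℝ (Fin (n.unop.len + 1))) (t : unitInterval) (i : Fin (n.unop.len + 1)) :
    contract g σ w t i = w i * contractFactor g (vert σ i) t (mass g σ w) := rfl

/-- The factor depends only on the label and on the mass of `g`, both preserved by simplicial
operators, so it is constant along the fibres of `f`. -/
lemma map_contract {m n : SimplexCategoryᵒᵖ} (f : n ⟶ m) (g : G) (σ : (ebar φ).obj n)
    (w : stdSimplex ℝ (Fin (m.unop.len + 1))) (t : unitInterval) :
    stdSimplex.map f.unop.toOrderHom (contract g ((ebar φ).map f σ) w t) =
      contract g σ (stdSimplex.map f.unop.toOrderHom w) t := by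
  ext j
  rw [contract_apply, stdSimplex.map_apply, stdSimplex.map_apply, sum_mul]
  refine sum_congr rfl fun i hi => ?_
  rw [contract_apply, vert_map, mass_map, (mem_filter.1 hi).2]

lemma contract_zero (g : G) {n : SimplexCategoryᵒᵖ} (σ : (ebar φ).obj n)
    (w : stdSimplex ℝ (Fin (n.unop.len + 1))) : contract g σ w 0 = w := by
  ext i
  simp [contract_apply, contractFactor]

lemma continuous_contract (g : G) {n : SimplexCategoryᵒᵖ} (σ : (ebar φ).obj n) :
    Continuous fun p : {w | 0 < mass g σ w} × unitInterval => contract g σ p.1 p.2 := by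
  refine Continuous.subtype_mk (continuous_pi fun i => ?_) _
  have h1 : Continuous fun p : {w | 0 < mass g σ w} × unitInterval => p.1.1 i :=
    (stdSimplex.continuous_eval i).comp (continuous_subtype_val.comp continuous_fst)
  have h2 : Continuous fun p : {w | 0 < mass g σ w} × unitInterval => mass g σ p.1.1 :=
    (continuous_mass g σ).comp (continuous_subtype_val.comp continuous_fst)
  have h3 : Continuous fun p : {w | 0 < mass g σ w} × unitInterval => (p.2 : ℝ) :=
    continuous_subtype_val.comp continuous_snd
  have h4 : Continuous fun p : {w | 0 < mass g σ w} × unitInterval => p.1.1 i * ((1 - (p.2 : ℝ)) +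
      (if vert σ i = g then (p.2 : ℝ) / mass g σ p.1.1 else 0)) := by
    split_ifs
    · exact h1.mul ((continuous_const.sub h3).add (h3.div h2 fun p => ne_of_gt p.1.2))
    · exact h1.mul ((continuous_const.sub h3).add continuous_const)
  refine h4.congr fun p => ?_
  have hp : 0 < mass g σ p.1.1 := p.1.2
  simp only [contractFactor, if_pos hp]

/-- The path in a simplex given by the straight line contraction. -/
noncomputable def contractLine (g : G) {n : SimplexCategoryᵒᵖ} (σ : (ebar φ).obj n)
    (w : stdSimplex ℝ (Fin (n.unop.len + 1))) :
    C(unitInterval, stdSimplex ℝ (Fin (n.unop.len + 1))) where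
  toFun t := contract g σ w t
  continuous_toFun := by
    by_cases h : 0 < mass g σ w
    · exact (continuous_contract g σ).comp (Continuous.prodMk_right ⟨w, h⟩)
    · have : ∀ t, contract g σ w t = w := fun t => by
        ext i
        simp [contract_apply, contractFactor, h]
      simp only [this, continuous_const]

/-- The path from a point of `EM φ` to the vertex `g`, if the point lies in the star of `g`. -/
noncomputable def track (g : G) (z : EM φ) : C(unitInterval, EM φ) :=
  (cell (exists_cell z).choose_spec.choose).comp
    (contractLine g (exists_cell z).choose_spec.choose
      (exists_cell z).choose_spec.choose_spec.choose)

lemma track_cell (g : G) {n : SimplexCategoryᵒᵖ} (σ : (ebar φ).obj n)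
    (w : stdSimplex ℝ (Fin (n.unop.len + 1))) :
    track g (cell σ w) = (cell σ).comp (contractLine g σ w) :=
  eq_of_realize_eq (X := ebar φ) (fun σ w => (cell σ).comp (contractLine g σ w))
    (fun f σ w => ContinuousMap.ext fun t => (cell_map f σ _).trans
      (congrArg (cell σ) (map_contract f g σ w t)))
    (exists_cell (cell σ w)).choose_spec.choose_spec.choose_spec

lemma track_zero (g : G) (z : EM φ) : track g z 0 = z := by
  obtain ⟨n, σ, w, rfl⟩ := exists_cell z
  rw [track_cell]
  exact congrArg (cell σ) (contract_zero g σ w)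

/-- Treating the homotopy as a map into the path space with the compact-open topology lets
continuity be checked on each simplex, with no need to realize a product with the interval. -/
lemma continuousOn_track (g : G) : ContinuousOn (track (φ := φ) g) (star φ g) := by
  rw [continuousOn_open_iff (isOpen_star g)]
  intro V hV
  refine isOpen_toTop_iff.2 fun n σ => ?_
  have h1 : IsOpen {w | 0 < mass g σ w} := isOpen_lt continuous_const (continuous_mass g σ)
  have h2 : ContinuousOn (fun w => (cell σ).comp (contractLine g σ w)) {w | 0 < mass g σ w} := by
    rw [continuousOn_iff_continuous_domRestrict]
    exact (ContinuousMap.curry (⟨fun p => cell σ (contract g σ p.1 p.2),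
      (cell σ).continuous.comp (continuous_contract g σ)⟩ :
        C({w | 0 < mass g σ w} × unitInterval, EM φ))).continuous
  convert (continuousOn_open_iff h1).1 h2 V hV using 1
  ext w
  change cell σ w ∈ star φ g ∧ track g (cell σ w) ∈ V ↔ _
  rw [track_cell, cell_mem_star]
  rfl

/-- Send `j` to the largest element of `S` up to `j`, or to the minimum of `S` if there is none. -/
lemma exists_orderHom_range_subset {n : ℕ} {S : Set (Fin n)} (hS : S.Nonempty) :
    ∃ ρ : Fin n →o Fin n, (∀ i, ρ i ∈ S) ∧ ∀ i ∈ S, ρ i = i := by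
  have hS' : (univ.filter (· ∈ S)).Nonempty := by
    obtain ⟨i, hi⟩ := hS
    exact ⟨i, by simpa using hi⟩
  set a := (univ.filter (· ∈ S)).min' hS' with ha
  have haS : a ∈ S := by simpa using Finset.min'_mem _ hS'
  have hle : ∀ i ∈ S, a ≤ i := fun i hi => Finset.min'_le _ _ (by simpa using hi)
  let T : Fin n → Finset (Fin n) := fun j => insert a (univ.filter fun i => i ∈ S ∧ i ≤ j)
  have hT : ∀ j, (T j).Nonempty := fun j => insert_nonempty _ _
  refine ⟨⟨fun j => (T j).max' (hT j), fun j k hjk => Finset.max'_subset _ ?_⟩, fun i => ?_,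
    fun i hi => ?_⟩
  · intro i hi
    simp only [T, mem_insert, mem_filter, mem_univ, true_and] at hi ⊢
    exact hi.imp id fun h => ⟨h.1, h.2.trans hjk⟩
  · have := Finset.max'_mem _ (hT i)
    simp only [T, mem_insert, mem_filter, mem_univ, true_and] at this
    rcases this with h | h
    · exact (congrArg (· ∈ S) h).mpr haS
    · exact h.1
  · have hiT : i ∈ T i := by simp [T, hi]
    refine le_antisymm (Finset.max'_le _ (hT i) _ fun j hj => ?_) (le_max' (T i) i hiT)
    · simp only [T, mem_insert, mem_filter, mem_univ, true_and] at hj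
      rcases hj with rfl | hj
      · exact hle i hi
      · exact hj.2

/-- Equal labels force every partial product to have image `1` under `φ`. By injectivity all entries
are `1`, so the simplex is a degeneracy of a vertex. -/
lemma cell_eq_vertexPoint (hinj : Function.Injective φ) {g : G} {n : SimplexCategoryᵒᵖ}
    {σ : (ebar φ).obj n} (hσ : ∀ i, vert σ i = g) (w : stdSimplex ℝ (Fin (n.unop.len + 1))) :
    cell σ w = vertexPoint φ g := by
  let π : Opposite.op (SimplexCategory.mk 0) ⟶ n :=
    (SimplexCategory.const n.unop (.mk 0) 0).op
  have h0 : σ.1 = g := by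
    have := hσ 0
    rwa [vert, Fin.val_zero, segProd_self, map_one, mul_one] at this
  have h1 : ∀ i : Fin (n.unop.len + 1), segProd σ.2 0 i = 1 := fun i => by
    have := hσ i
    rw [vert, h0, mul_eq_left] at this
    exact hinj (this.trans (map_one φ).symm)
  have h2 : ∀ i, σ.2 i = 1 := fun i => by
    have := segProd_mul σ.2 (Nat.zero_le (i : ℕ)) (Nat.le_succ i)
    have h3 := h1 i.castSucc
    have h4 := h1 i.succ
    rw [Fin.val_castSucc] at h3
    rw [Fin.val_succ] at h4
    rw [h3, one_mul, Nat.succ_eq_add_one, h4, segProd_succ] at this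
    exact this
  have h3 : σ = (ebar φ).map π (tuple φ g Fin.elim0) := by
    refine Prod.ext ?_ (funext fun i => (h2 i).trans (segProd_self _ _).symm)
    refine h0.trans ?_
    change g = g * φ (segProd _ 0 0)
    rw [segProd_self, map_one, mul_one]
  rw [h3, cell_map]
  exact congrArg (cell _) (Subsingleton.elim _ _)

/-- At time `1` only vertices labelled `g` carry weight. An order-preserving retraction onto them
fixes this point, which thus lies on a simplex with all labels equal to `g`. -/
lemma track_one (hinj : Function.Injective φ) {g : G} {z : EM φ} (hz : z ∈ star φ g) :
    track g z 1 = vertexPoint φ g := by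
  obtain ⟨n, σ, w, rfl⟩ := exists_cell z
  rw [cell_mem_star] at hz
  obtain ⟨ρ, hρ, hρ'⟩ := exists_orderHom_range_subset (S := {i | vert σ i = g}) (by
    by_contra h
    rw [Set.not_nonempty_iff_eq_empty, Set.eq_empty_iff_forall_notMem] at h
    have : mass g σ w = 0 := by
      exact sum_eq_zero fun i hi => absurd (mem_filter.1 hi).2 (h i)
    exact hz.ne' this)
  let f : n ⟶ n := (SimplexCategory.mkHom (n := n.unop.len) (m := n.unop.len) ρ).op
  have h1 : stdSimplex.map f.unop.toOrderHom (contract g σ w 1) = contract g σ w 1 := by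
    have h0 : ∀ i, vert σ i ≠ g → contract g σ w 1 i = 0 := fun i hi => by
      simp [contract_apply, contractFactor, hz, hi]
    ext j
    rw [stdSimplex.map_apply]
    change ∑ i with ρ i = j, _ = _
    by_cases hj : vert σ j = g
    · rw [sum_eq_single_of_mem j (by simpa using hρ' j hj)]
      intro i hi hij
      refine h0 i fun hi' => hij ?_
      rw [← hρ' i hi']
      exact (mem_filter.1 hi).2
    · rw [filter_false_of_mem, sum_empty, h0 j hj]
      rintro i - rfl
      exact hj (hρ i)
  rw [track_cell]
  change cell σ (contract g σ w 1) = _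
  rw [← h1, ← cell_map]
  exact cell_eq_vertexPoint hinj (fun i => (vert_map f σ i).trans (hρ i)) _

end BarConstruction

/-! ### Cocycles on paths -/

/-- A function on the paths of a space with values in a group which is multiplicative under
concatenation and invariant under homotopies relative to the endpoints. -/
structure PathCocycle (X : Type*) [TopologicalSpace X] (π : Type*) [Group π] where
  toFun {x y : X} (γ : Path x y) : π
  trans {x y z : X} (γ : Path x y) (δ : Path y z) : toFun (γ.trans δ) = toFun γ * toFun δ
  homotopic {x y : X} {γ δ : Path x y} (h : γ.Homotopic δ) : toFun γ = toFun δ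

namespace PathCocycle

variable {X Y : Type*} [TopologicalSpace X] [TopologicalSpace Y] {π : Type*} [Group π]

/-- The pullback of a path cocycle. -/
def comap (L : PathCocycle X π) (f : C(Y, X)) : PathCocycle Y π where
  toFun γ := L.toFun (γ.map f.continuous)
  trans γ δ := by rw [Path.map_trans, L.trans]
  homotopic h := L.homotopic (h.map f)

variable (L : PathCocycle X π)

lemma toFun_cast {x y x' y' : X} (γ : Path x y) (hx : x' = x) (hy : y' = y) :
    L.toFun (γ.cast hx hy) = L.toFun γ := by
  subst hx hy
  rfl

lemma toFun_congr {x y x' y' : X} {γ : Path x y} {δ : Path x' y'} (h : ∀ t, γ t = δ t) :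
    L.toFun γ = L.toFun δ := by
  have hx : x' = x := by rw [← γ.source, h, δ.source]
  have hy : y' = y := by rw [← γ.target, h, δ.target]
  rw [← L.toFun_cast δ hx.symm hy.symm]
  congr 1
  ext t
  exact h t

lemma toFun_refl (x : X) : L.toFun (Path.refl x) = 1 := by
  have h := L.trans (Path.refl x) (Path.refl x)
  rw [Path.refl_trans_refl] at h
  exact mul_eq_left.1 h.symm

lemma toFun_eq_of_simplyConnected [SimplyConnectedSpace X] {x y : X} (γ δ : Path x y) :
    L.toFun γ = L.toFun δ :=
  L.homotopic (SimplyConnectedSpace.paths_homotopic γ δ)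

/-- The value of a path cocycle on a path between two points of a path connected space. -/
noncomputable def val [PathConnectedSpace X] (x y : X) : π :=
  L.toFun (PathConnectedSpace.somePath x y)

lemma toFun_eq_val [SimplyConnectedSpace X] {x y : X} (γ : Path x y) : L.toFun γ = L.val x y :=
  L.toFun_eq_of_simplyConnected _ _

lemma val_mul_val [SimplyConnectedSpace X] (x y z : X) : L.val x y * L.val y z = L.val x z := by
  rw [← L.toFun_eq_val ((PathConnectedSpace.somePath x y).trans (PathConnectedSpace.somePath y z)),
    L.trans]
  rfl

lemma val_self [SimplyConnectedSpace X] (x : X) : L.val x x = 1 := by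
  rw [← L.toFun_eq_val (Path.refl x), L.toFun_refl]

lemma comap_val_map [SimplyConnectedSpace Y] {Z : Type*} [TopologicalSpace Z]
    [SimplyConnectedSpace Z] (f : C(Y, X)) (k : C(Z, Y)) (f' : C(Z, X)) (hf : ∀ z, f' z = f (k z))
    (x y : Z) : (L.comap f').val x y = (L.comap f).val (k x) (k y) := by
  rw [← (L.comap f).toFun_eq_val ((PathConnectedSpace.somePath x y).map k.continuous)]
  exact L.toFun_congr fun t => hf _

instance : ContractibleSpace unitInterval :=
  (convex_Icc (0 : ℝ) 1).contractibleSpace ⟨0, by simp⟩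

/-- A homotopy between paths, not necessarily fixing the endpoints. -/
lemma toFun_mul_toFun_of_square (K : C(unitInterval × unitInterval, X)) {a b c d : X}
    {bottom : Path a b} {top : Path c d} {left : Path a c} {right : Path b d}
    (hbottom : ∀ s, bottom s = K (s, 0)) (htop : ∀ s, top s = K (s, 1))
    (hleft : ∀ t, left t = K (0, t)) (hright : ∀ t, right t = K (1, t)) :
    L.toFun bottom * L.toFun right = L.toFun left * L.toFun top := by
  -- The square is simply connected, so the pulled-back cocycle depends only on endpoints.
  have key : ∀ {x y : X} (γ : Path x y) (k : C(unitInterval, unitInterval × unitInterval)),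
      (∀ t, γ t = K (k t)) → L.toFun γ = (L.comap K).val (k 0) (k 1) := fun γ k hk => by
    rw [← (L.comap K).toFun_eq_val (⟨k, rfl, rfl⟩ : Path (k 0) (k 1))]
    exact L.toFun_congr hk
  rw [key bottom (.prodMk (.id _) (.const _ 0)) hbottom,
    key top (.prodMk (.id _) (.const _ 1)) htop,
    key left (.prodMk (.const _ 0) (.id _)) hleft, key right (.prodMk (.const _ 1) (.id _)) hright]
  simp only [ContinuousMap.prod_eval, ContinuousMap.id_apply, ContinuousMap.const_apply,
    val_mul_val]

/-- A path cocycle is trivialized by `t` as soon as this holds locally. -/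
lemma mul_toFun_eq_of_local {t : X → π} {U : X → Set X} (hU : ∀ x, IsOpen (U x))
    (hx : ∀ x, x ∈ U x)
    (h : ∀ x {y z : X} (γ : Path y z), (∀ s, γ s ∈ U x) → t y * L.toFun γ = t z)
    {y z : X} (γ : Path y z) : t y * L.toFun γ = t z := by
  let γ' : C(unitInterval, X) := γ
  -- `ψ s` is the defect of the identity on the part of `γ` up to `s`. It is locally constant, hence
  -- constant, which replaces a subdivision of the interval.
  let ψ : unitInterval → π := fun s => t (γ 0) * (L.comap γ').val 0 s * (t (γ s))⁻¹
  have := (convex_Icc (0 : ℝ) 1).locallyPathConnectedSpace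
  have hψ : IsLocallyConstant ψ := by
    rw [IsLocallyConstant.iff_eventually_eq]
    intro s
    obtain ⟨N, ⟨hN, hNc, hNU⟩, -⟩ := (pathConnected_subset_basis
      ((hU (γ s)).preimage γ.continuous) (hx (γ s))).mem_iff.1
      (((hU (γ s)).preimage γ.continuous).mem_nhds (hx (γ s)))
    filter_upwards [hN] with r hr
    obtain ⟨δ, hδ⟩ := hNc.joinedIn s (mem_of_mem_nhds hN) r hr
    have h1 := h (γ s) (δ.map γ.continuous) fun q => hNU (hδ q)
    have h2 : L.toFun (δ.map γ.continuous) = (L.comap γ').val s r :=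
      (L.comap γ').toFun_eq_val δ
    simp only [ψ]
    rw [← (L.comap γ').val_mul_val 0 s r, ← h2, ← h1]
    group
  have h01 := hψ.apply_eq_of_isPreconnected isPreconnected_univ (Set.mem_univ 0) (Set.mem_univ 1)
  have h3 : (L.comap γ').val 0 1 = L.toFun γ := by
    rw [← (L.comap γ').toFun_eq_val (⟨.id _, rfl, rfl⟩ : Path (0 : unitInterval) 1)]
    exact L.toFun_congr fun _ => rfl
  simp only [ψ, val_self, h3] at h01
  simp only [γ.source, γ.target, mul_one, mul_inv_cancel] at h01
  exact (mul_inv_eq_one.1 h01.symm)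

lemma symm_trans_cancel_left {x y z : X} (s : Path.Homotopic.Quotient x y)
    (c : Path.Homotopic.Quotient y z) : s.symm.trans (s.trans c) = c := by
  rw [← Path.Homotopic.Quotient.trans_assoc, Path.Homotopic.Quotient.symm_trans,
    Path.Homotopic.Quotient.refl_trans]

/-- The cocycle with values in the fundamental group obtained by joining the endpoints of a path
to the base point. -/
noncomputable def ofFundamentalGroup [PathConnectedSpace X] (b : X) :
    PathCocycle X (FundamentalGroup X b) where
  -- Multiplication in `FundamentalGroup` reverses concatenation; the inverse restores the order.
  toFun {x y} γ := (FundamentalGroup.fromPath (.mk (((PathConnectedSpace.somePath b x).trans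
    γ).trans (PathConnectedSpace.somePath b y).symm)))⁻¹
  trans {x y z} γ δ := by
    rw [← mul_inv_rev]
    refine congrArg _ ?_
    rw [FundamentalGroup.mul_def]
    simp only [Path.Homotopic.Quotient.mk_trans, Path.Homotopic.Quotient.mk_symm]
    generalize Path.Homotopic.Quotient.mk γ = c
    generalize Path.Homotopic.Quotient.mk δ = d
    simp only [Path.Homotopic.Quotient.trans_assoc]
    generalize Path.Homotopic.Quotient.mk (PathConnectedSpace.somePath b y) = s
    generalize Path.Homotopic.Quotient.mk (PathConnectedSpace.somePath b z) = r
    change _ = Path.Homotopic.Quotient.trans _ (c.trans (s.symm.trans (s.trans (d.trans r.symm))))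
    rw [symm_trans_cancel_left]
  homotopic h := by
    refine congrArg _ ?_
    simp only [Path.Homotopic.Quotient.mk_trans, Path.Homotopic.Quotient.eq.2 h]

lemma homotopic_refl_of_ofFundamentalGroup_eq_one [PathConnectedSpace X] {b : X} {γ : Path b b}
    (h : (ofFundamentalGroup b).toFun γ = 1) : γ.Homotopic (Path.refl b) := by
  have h' := inv_eq_one.1 h
  rw [FundamentalGroup.one_def] at h'
  simp only [Path.Homotopic.Quotient.mk_trans, Path.Homotopic.Quotient.mk_symm] at h'
  rw [← Path.Homotopic.Quotient.eq]
  generalize Path.Homotopic.Quotient.mk γ = c at *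
  generalize Path.Homotopic.Quotient.mk (PathConnectedSpace.somePath b b) = s at *
  change (s.trans c).trans s.symm = .refl b at h'
  calc c = s.symm.trans ((((s.trans c).trans s.symm)).trans s) := by
        simp only [Path.Homotopic.Quotient.trans_assoc, Path.Homotopic.Quotient.symm_trans,
          Path.Homotopic.Quotient.trans_refl, symm_trans_cancel_left]
    _ = .mk (Path.refl b) := by
        rw [h', Path.Homotopic.Quotient.refl_trans, Path.Homotopic.Quotient.symm_trans]
        rfl

end PathCocycle

/-! ### Consequences of the universal property of a groupification -/

namespace IsGroupification

variable {M G : Type u} [Monoid M] [Group G] {φ : M →* G} (hφ : IsGroupification φ)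

include hφ

lemma hom_ext {H : Type u} [Group H] {F F' : G →* H} (h : F.comp φ = F'.comp φ) : F = F' :=
  (hφ H (F'.comp φ)).unique h rfl

/-- Extend the corestriction of `φ` to `F : G →* N`. By uniqueness, `F` followed by the inclusion of
`N` is the identity. -/
lemma closure_range : Subgroup.closure (Set.range φ) = ⊤ := by
  let N := Subgroup.closure (Set.range φ)
  let f : M →* N := φ.codRestrict N fun x => Subgroup.subset_closure ⟨x, rfl⟩
  obtain ⟨F, hF, -⟩ := hφ N f
  have h : N.subtype.comp F = MonoidHom.id G := hφ.hom_ext (by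
    rw [MonoidHom.comp_assoc, hF]
    rfl)
  refine eq_top_iff.2 fun g _ => ?_
  have := (F g).2
  rwa [show ((F g : N) : G) = g from DFunLike.congr_fun h g] at this

end IsGroupification

/-- Right translation of functions on a group. -/
def rightTranslation (G π : Type*) [Group G] [Group π] : G →* MulAut (G → π) where
  toFun h :=
    { toFun := fun k a => k (a * h)
      invFun := fun k a => k (a * h⁻¹)
      left_inv := fun k => by simp
      right_inv := fun k => by simp
      map_mul' := fun _ _ => rfl }
  map_one' := by
    ext k a
    simp
  map_mul' g h := by
    ext k a
    simp [mul_assoc]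

/-- A cocycle on the translation category of `M` acting on its groupification is a coboundary. -/
lemma IsGroupification.exists_trivialization {M G : Type u} [Monoid M] [Group G] {φ : M →* G}
    (hφ : IsGroupification φ) {π : Type u} [Group π] {l : G → M → π}
    (hl : ∀ g x y, l g (x * y) = l g x * l (g * φ x) y) :
    ∃ t : G → π, ∀ g x, t (g * φ x) = t g * l g x := by
  have hl1 : ∀ g, l g 1 = 1 := fun g => by
    have := hl g 1 1
    rw [mul_one, map_one, mul_one] at this
    exact mul_eq_left.1 this.symm
  -- Multiplicativity of `x ↦ (l · x, φ x)` is exactly the cocycle identity.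
  let f : M →* (G → π) ⋊[rightTranslation G π] G :=
    { toFun := fun x => ⟨fun a => l a x, φ x⟩
      map_one' := SemidirectProduct.ext (funext hl1) (map_one φ)
      map_mul' := fun x y => SemidirectProduct.ext (funext fun a => hl a x y) (map_mul φ x y) }
  obtain ⟨F, hF, -⟩ := hφ _ f
  have h : SemidirectProduct.rightHom.comp F = MonoidHom.id G := hφ.hom_ext (by
    rw [MonoidHom.comp_assoc, hF]
    rfl)
  -- Evaluating the left component of `F g * f x` at `1` gives `t g * l (1 * g) x`.
  refine ⟨fun g => (F g).left 1, fun g x => ?_⟩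
  have h1 : F (φ x) = f x := DFunLike.congr_fun hF x
  have h2 : (F g).right = g := DFunLike.congr_fun h g
  simp only [map_mul, SemidirectProduct.mul_left, h1, h2]
  change _ * l (1 * g) x = _
  rw [one_mul]

/-! ### Path cocycles on `EM φ` are coboundaries -/

instance {n : ℕ} : ContractibleSpace (stdSimplex ℝ (Fin (n + 1))) :=
  (convex_stdSimplex ℝ (Fin (n + 1))).contractibleSpace
    ⟨_, (Classical.arbitrary (stdSimplex ℝ (Fin (n + 1)))).2⟩

namespace BarConstruction

open CategoryTheory Realization Topology

variable {M G : Type u} [Monoid M] [Group G] {φ : M →* G}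

lemma cell_vertex (hinj : Function.Injective φ) {n : SimplexCategoryᵒᵖ} (σ : (ebar φ).obj n)
    (i : Fin (n.unop.len + 1)) : cell σ (stdSimplex.vertex i) = vertexPoint φ (vert σ i) := by
  let f : n ⟶ Opposite.op (SimplexCategory.mk 0) := (SimplexCategory.const (.mk 0) n.unop i).op
  have : stdSimplex.map f.unop.toOrderHom (stdSimplex.vertex 0) =
    stdSimplex.vertex (S := ℝ) i := stdSimplex.map_vertex _ _
  rw [← this, ← cell_map]
  exact cell_eq_vertexPoint hinj (fun j => vert_map f σ j) _

lemma joined_cell {n : SimplexCategoryᵒᵖ} (σ : (ebar φ).obj n)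
    (v w : stdSimplex ℝ (Fin (n.unop.len + 1))) : Joined (cell σ v) (cell σ w) :=
  (PathConnectedSpace.joined v w).map (cell σ).continuous

/-- The edge `[g|x]`. -/
def edge (φ : M →* G) (g : G) (x : M) : (ebar φ).obj (.op (.mk 1)) :=
  tuple φ (n := .op (.mk 1)) g fun _ => x

/-- The `2`-simplex `[g|x|y]`. -/
def triangle (φ : M →* G) (g : G) (x y : M) : (ebar φ).obj (.op (.mk 2)) :=
  tuple φ (n := .op (.mk 2)) g ![x, y]

lemma vert_zero {n : SimplexCategoryᵒᵖ} (σ : (ebar φ).obj n) : vert σ 0 = σ.1 := by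
  rw [vert, Fin.val_zero, segProd_self, map_one, mul_one]

lemma joined_vertexPoint_mul (hinj : Function.Injective φ) (g : G) (x : M) :
    Joined (vertexPoint φ g) (vertexPoint φ (g * φ x)) := by
  have h0 : vert (edge φ g x) 0 = g := vert_zero _
  have h1 : vert (edge φ g x) 1 = g * φ x :=
    congrArg (fun y => g * φ y) (segProd_succ (fun _ : Fin 1 => x) 0)
  have := joined_cell (edge φ g x) (stdSimplex.vertex 0) (stdSimplex.vertex 1)
  rwa [cell_vertex hinj, cell_vertex hinj, h0, h1] at this

lemma joined_vertexPoint (hφ : IsGroupification φ) (hinj : Function.Injective φ) (g h : G) :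
    Joined (vertexPoint φ g) (vertexPoint φ h) := by
  have key : ∀ k ∈ Subgroup.closure (Set.range φ), ∀ g,
      Joined (vertexPoint φ g) (vertexPoint φ (g * k)) := by
    intro k hk
    induction hk using Subgroup.closure_induction with
    | mem k hk =>
      obtain ⟨x, rfl⟩ := hk
      exact fun g => joined_vertexPoint_mul hinj g x
    | one => exact fun g => by rw [mul_one]
    | mul k l _ _ hk hl => exact fun g => (hk g).trans (mul_assoc g k l ▸ hl (g * k))
    | inv k _ hk => exact fun g => by simpa using (hk (g * k⁻¹)).symm
  have := key (g⁻¹ * h) (hφ.closure_range ▸ Subgroup.mem_top _) g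
  rwa [mul_inv_cancel_left] at this

lemma pathConnectedSpace (hφ : IsGroupification φ) (hinj : Function.Injective φ) :
    PathConnectedSpace (EM φ) := by
  have key : ∀ z : EM φ, Joined (vertexPoint φ 1) z := fun z => by
    obtain ⟨n, σ, w, rfl⟩ := exists_cell z
    have := joined_cell σ (stdSimplex.vertex 0) w
    rw [cell_vertex hinj] at this
    exact (joined_vertexPoint hφ hinj _ _).trans this
  exact ⟨⟨vertexPoint φ 1⟩, fun y z => (key y).symm.trans (key z)⟩

/-! ### Trivializing a path cocycle, from the vertices to all of `EM φ` -/

section Cocycle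

variable {π : Type u} [Group π] (L : PathCocycle (EM φ) π)

/-- The value of a path cocycle on the image of a path in a simplex. -/
noncomputable def cellVal {n : SimplexCategoryᵒᵖ} (σ : (ebar φ).obj n)
    (v w : stdSimplex ℝ (Fin (n.unop.len + 1))) : π :=
  (L.comap (cell σ)).val v w

lemma cellVal_mul_cellVal {n : SimplexCategoryᵒᵖ} (σ : (ebar φ).obj n)
    (u v w : stdSimplex ℝ (Fin (n.unop.len + 1))) :
    cellVal L σ u v * cellVal L σ v w = cellVal L σ u w :=
  (L.comap (cell σ)).val_mul_val u v w

lemma toFun_eq_cellVal {n : SimplexCategoryᵒᵖ} (σ : (ebar φ).obj n)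
    (δ : C(unitInterval, stdSimplex ℝ (Fin (n.unop.len + 1)))) {a b : EM φ} {γ : Path a b}
    (hγ : ∀ t, γ t = cell σ (δ t)) : L.toFun γ = cellVal L σ (δ 0) (δ 1) := by
  rw [cellVal, ← (L.comap (cell σ)).toFun_eq_val (⟨δ, rfl, rfl⟩ : Path (δ 0) (δ 1))]
  exact L.toFun_congr hγ

lemma cellVal_map {m n : SimplexCategoryᵒᵖ} (f : n ⟶ m) (σ : (ebar φ).obj n)
    (v w : stdSimplex ℝ (Fin (m.unop.len + 1))) :
    cellVal L ((ebar φ).map f σ) v w = cellVal L σ (stdSimplex.map f.unop.toOrderHom v)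
      (stdSimplex.map f.unop.toOrderHom w) :=
  L.comap_val_map (cell σ) ⟨_, stdSimplex.continuous_map _⟩ _ (fun z => cell_map f σ z) v w

/-- The value of a path cocycle on the edge `[g|x]`. -/
noncomputable def edgeVal (g : G) (x : M) : π :=
  cellVal L (edge φ g x) (stdSimplex.vertex 0) (stdSimplex.vertex 1)

lemma cellVal_vertex {n : SimplexCategoryᵒᵖ} (σ : (ebar φ).obj n) {i j : Fin (n.unop.len + 1)}
    (hij : i ≤ j) : cellVal L σ (stdSimplex.vertex i) (stdSimplex.vertex j) =
      edgeVal L (vert σ i) (segProd σ.2 i j) := by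
  let θ : Fin 2 →o Fin (n.unop.len + 1) := ⟨![i, j], by
    intro a b hab
    fin_cases a <;> fin_cases b <;> first | exact le_rfl | exact hij | exact absurd hab (by decide)⟩
  let f : n ⟶ Opposite.op (SimplexCategory.mk 1) :=
    (SimplexCategory.mkHom (n := 1) (m := n.unop.len) θ).op
  have h : (ebar φ).map f σ = edge φ (vert σ i) (segProd σ.2 i j) := by
    refine Prod.ext rfl (funext fun k => ?_)
    have : k = (0 : Fin 1) := Subsingleton.elim _ _
    subst this
    rfl
  have h0 : stdSimplex.map f.unop.toOrderHom (stdSimplex.vertex 0) =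
    stdSimplex.vertex (S := ℝ) i := stdSimplex.map_vertex _ _
  have h1 : stdSimplex.map f.unop.toOrderHom (stdSimplex.vertex 1) =
    stdSimplex.vertex (S := ℝ) j := stdSimplex.map_vertex _ _
  rw [edgeVal, ← h, cellVal_map, h0, h1]

/-- The three edges bound the triangle `[g|x|y]`, on which the cocycle depends only on endpoints. -/
lemma edgeVal_mul (g : G) (x y : M) :
    edgeVal L g (x * y) = edgeVal L g x * edgeVal L (g * φ x) y := by
  have h01 : segProd ![x, y] 0 1 = x := segProd_succ ![x, y] 0
  have h12 : segProd ![x, y] 1 2 = y := segProd_succ ![x, y] 1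
  have h02 : segProd ![x, y] 0 2 = x * y := by
    rw [← segProd_mul _ (zero_le_one) (Nat.le_succ 1), h01, h12]
  have h := cellVal_mul_cellVal L (triangle φ g x y) (stdSimplex.vertex 0) (stdSimplex.vertex 1)
    (stdSimplex.vertex 2)
  rw [cellVal_vertex L _ (Fin.zero_le _), cellVal_vertex L _ (Fin.le_def.2 (Nat.le_succ 1)),
    cellVal_vertex L _ (Fin.zero_le _), vert_zero] at h
  have e1 : vert (triangle φ g x y) 1 = g * φ x := congrArg (fun z => g * φ z) h01
  rw [e1] at h
  refine Eq.trans ?_ (h.symm.trans ?_)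
  · exact congrArg (edgeVal L g) h02.symm
  · exact congrArg₂ (fun a b => edgeVal L g a * edgeVal L (g * φ x) b) h01 h12

variable (t : G → π)

/-- The extension of a function on the vertices along the straight lines in a simplex. -/
noncomputable def simplexVal {n : SimplexCategoryᵒᵖ} (σ : (ebar φ).obj n)
    (w : stdSimplex ℝ (Fin (n.unop.len + 1))) : π :=
  t (vert σ 0) * cellVal L σ (stdSimplex.vertex 0) w

/-- The extension of a function on the vertices to `EM φ`. -/
noncomputable def pointVal (z : EM φ) : π :=
  simplexVal L t (exists_cell z).choose_spec.choose
    (exists_cell z).choose_spec.choose_spec.choose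

variable {L t} (ht : ∀ g x, t (g * φ x) = t g * edgeVal L g x)

include ht

/-- An operator may move the initial vertex; `ht` says that `t` changes by the value on the edge
from the old one to the new one, which the cocycle absorbs. -/
lemma simplexVal_map {m n : SimplexCategoryᵒᵖ} (f : n ⟶ m) (σ : (ebar φ).obj n)
    (w : stdSimplex ℝ (Fin (m.unop.len + 1))) :
    simplexVal L t ((ebar φ).map f σ) w =
      simplexVal L t σ (stdSimplex.map f.unop.toOrderHom w) := by
  have h0 : stdSimplex.map f.unop.toOrderHom (stdSimplex.vertex 0) =
    stdSimplex.vertex (S := ℝ) (f.unop.toOrderHom 0) := stdSimplex.map_vertex _ _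
  have h1 : t (vert σ (f.unop.toOrderHom 0)) = t (vert σ 0) *
      cellVal L σ (stdSimplex.vertex 0) (stdSimplex.vertex (f.unop.toOrderHom 0)) := by
    rw [cellVal_vertex L σ (Fin.zero_le _), ← ht, vert_zero]
    rfl
  rw [simplexVal, simplexVal, vert_map, cellVal_map, h0, h1, mul_assoc, cellVal_mul_cellVal]

lemma pointVal_cell {n : SimplexCategoryᵒᵖ} (σ : (ebar φ).obj n)
    (w : stdSimplex ℝ (Fin (n.unop.len + 1))) :
    pointVal L t (cell σ w) = simplexVal L t σ w :=
  eq_of_realize_eq (X := ebar φ) (simplexVal L t) (simplexVal_map ht)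
    (exists_cell (cell σ w)).choose_spec.choose_spec.choose_spec

lemma pointVal_mul_toFun_of_cell {n : SimplexCategoryᵒᵖ} (σ : (ebar φ).obj n)
    (δ : C(unitInterval, stdSimplex ℝ (Fin (n.unop.len + 1)))) {a b : EM φ} {γ : Path a b}
    (hγ : ∀ s, γ s = cell σ (δ s)) : pointVal L t a * L.toFun γ = pointVal L t b := by
  have ha : a = cell σ (δ 0) := by rw [← hγ, γ.source]
  have hb : b = cell σ (δ 1) := by rw [← hγ, γ.target]
  rw [toFun_eq_cellVal L σ δ hγ, ha, hb, pointVal_cell ht, pointVal_cell ht, simplexVal,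
    simplexVal, mul_assoc, cellVal_mul_cellVal]

/-- The path `γ` may cross many simplices, but each track stays in one, where the identity is known.
Contracting `γ` to the vertex `g` gives a square with constant top, so `γ` has the value of the
track of `a` followed by the reversed track of `b`. -/
lemma pointVal_mul_toFun_of_star (hinj : Function.Injective φ) (g : G) {a b : EM φ}
    (γ : Path a b) (hγ : ∀ s, γ s ∈ star φ g) : pointVal L t a * L.toFun γ = pointVal L t b := by
  have ha : a ∈ star φ g := by simpa using hγ 0
  have hb : b ∈ star φ g := by simpa using hγ 1
  let τ : ∀ z ∈ star φ g, Path z (vertexPoint φ g) := fun z hz =>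
    ⟨track g z, track_zero g z, track_one hinj hz⟩
  have hτ : ∀ z hz, pointVal L t z * L.toFun (τ z hz) = pointVal L t (vertexPoint φ g) := by
    intro z hz
    obtain ⟨n, σ, w, rfl⟩ := exists_cell z
    exact pointVal_mul_toFun_of_cell ht σ (contractLine g σ w)
      fun s => DFunLike.congr_fun (track_cell g σ w) s
  let K : C(unitInterval × unitInterval, EM φ) := ContinuousMap.uncurry
    ⟨fun s => track g (γ s), (continuousOn_track g).comp_continuous γ.continuous hγ⟩
  have hK := L.toFun_mul_toFun_of_square K (bottom := γ) (top := Path.refl (vertexPoint φ g))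
    (left := τ a ha) (right := τ b hb) (fun s => (track_zero g (γ s)).symm)
    (fun s => (track_one hinj (hγ s)).symm) (fun s => congrArg (track g · s) γ.source.symm)
    (fun s => congrArg (track g · s) γ.target.symm)
  rw [L.toFun_refl, mul_one] at hK
  have := hτ a ha
  rw [← hK, ← hτ b hb, ← mul_assoc] at this
  exact mul_right_cancel this

lemma pointVal_mul_toFun (hinj : Function.Injective φ) {a b : EM φ} (γ : Path a b) :
    pointVal L t a * L.toFun γ = pointVal L t b :=
  L.mul_toFun_eq_of_local (U := fun z => star φ (exists_mem_star z).choose)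
    (fun _ => isOpen_star _) (fun z => (exists_mem_star z).choose_spec)
    (fun _ _ _ γ hγ => pointVal_mul_toFun_of_star ht hinj _ γ hγ) γ

end Cocycle

lemma simplyConnectedSpace (hφ : IsGroupification φ) (hinj : Function.Injective φ) :
    SimplyConnectedSpace (EM φ) := by
  have := pathConnectedSpace hφ hinj
  refine simply_connected_iff_loops_nullhomotopic.2 ⟨this, fun b γ => ?_⟩
  let L := PathCocycle.ofFundamentalGroup (X := EM φ) b
  obtain ⟨t, ht⟩ := hφ.exists_trivialization (edgeVal_mul L)
  -- For a loop, `pointVal` is the same at both ends and cancels, so `L` is `1` on it.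
  exact PathCocycle.homotopic_refl_of_ofFundamentalGroup_eq_one
    (mul_eq_left.1 (pointVal_mul_toFun ht hinj γ))

end BarConstruction

theorem mainTheorem7 {M G : Type u} [Monoid M] [Group G] (φ : M →* G)
    (hφ : IsGroupification φ) (hinj : Function.Injective φ) :
    (∀ h : G, Continuous fun z : EM φ => h • z) ∧
    (∀ (h : G) (z : EM φ), h • z = z → h = 1) ∧
    IsCoveringMap (EM.toOrbitSpace φ) ∧
    ∃ e : EM.OrbitSpace φ ≃ₜ BM M,
      (∀ z : EM φ, e (EM.toOrbitSpace φ z) = EM.toBM φ z) ∧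
      IsUniversalCover (fun z : EM φ => e (EM.toOrbitSpace φ z)) := by
  have hq : IsQuotientCoveringMap (EM.toBM φ) G := BarConstruction.isQuotientCoveringMap_toBM
  refine ⟨BarConstruction.continuous_smul, fun h z hz => ?_, ?_,
    BarConstruction.orbitSpaceHomeomorph φ, fun z => rfl, ?_⟩
  · have := hq.isCancelSMul
    exact IsCancelSMul.right_cancel h 1 z (hz.trans (one_smul G z).symm)
  · exact ((IsQuotientCoveringMap.homeomorph_comp_iff (f := EM.toOrbitSpace φ) (G := G)
      (BarConstruction.orbitSpaceHomeomorph φ)).1 hq).isCoveringMap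
  · exact ⟨hq.isCoveringMap, BarConstruction.toBM_surjective,
      BarConstruction.simplyConnectedSpace hφ hinj⟩
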